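/- Let $G$ be a locally compact, second countable, Hausdorff topological group, and let $G_1\subset G_2\subset G_3\subset\cdots$ be an ascending sequence of open subgroups of $G$ with $\bigcup_n G_n=G$. For a locally compact, second countable, Hausdorff group $H$, let $\underline{M}H$ be the set of compactly supported positive Borel measures on $H$ with total mass in $(1/2,1]$, with the weak* topology (the coarsest topology for which $\nu\mapsto\int f\,d\nu$ is continuous for every continuous compactly supported $f\colon H\to\mathbb{R}$), on which $H$ acts by left translation. Regard $\underline{M}G_n$ as a subset of $\underline{M}G$ by extending measures by zero, and let $(\underline{M}G)_{\lim}$ be the set $\underline{M}G=\bigcup_n\underline{M}G_n$ with the direct limit topology: a subset is open if and only if its intersection with each $\underline{M}G_n$ is open in $\underline{M}G_n$. Then $G$ acts continuously on both $\underline{M}G$ and $(\underline{M}G)_{\lim}$, and these two $G$-spaces are $G$-homotopy equivalent. More precisely, the identity map $(\underline{M}G)_{\lim}\to\underline{M}G$ is continuous and $G$-equivariant, and there is a continuous $G$-equivariant map $\Xi\colon\underline{M}G\to(\underline{M}G)_{\lim}$ such that both composites of $\Xi$ with the identity map are homotopic, through $G$-equivariant maps, to the respective identity maps. -/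

import Mathlib

open MeasureTheory Topology
open scoped ENNReal CompactlySupported

section KasparovSkandalis

/-- The set of all compactly supported positive Borel measures on `G` of total mass in
`(1/2, 1]`. On a second countable locally compact Hausdorff space every finite Borel measure is
Radon, so no separate regularity condition is needed. -/
@[ext]
structure KSSpace (G : Type*) [TopologicalSpace G] [MeasurableSpace G] where
  /-- the underlying measure -/
  meas : Measure G
  compactSupport : ∃ K : Set G, IsCompact K ∧ meas Kᶜ = 0
  half_lt_mass : 1 / 2 < meas Set.univ
  mass_le_one : meas Set.univ ≤ 1

namespace KSSpace

/-- The weak* topology: the coarsest topology for which `ν ↦ ∫ f dν` is continuous for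
every continuous compactly supported `f`. -/
noncomputable instance instTopologicalSpace (G : Type*) [TopologicalSpace G] [MeasurableSpace G] :
    TopologicalSpace (KSSpace G) :=
  TopologicalSpace.induced
    (fun (ν : KSSpace G) (f : C_c(G, ℝ)) => ∫ x, f x ∂ν.meas) inferInstance

/-- Pushforward of measures along a continuous map. -/
noncomputable def map {G H : Type*} [TopologicalSpace G] [MeasurableSpace G] [BorelSpace G]
    [TopologicalSpace H] [T2Space H] [MeasurableSpace H] [BorelSpace H]
    (φ : G → H) (hφ : Continuous φ) (ν : KSSpace G) : KSSpace H where
  meas := ν.meas.map φ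
  compactSupport := by
    obtain ⟨K, hK, h0⟩ := ν.compactSupport
    refine ⟨φ '' K, hK.image hφ, ?_⟩
    rw [Measure.map_apply hφ.measurable (hK.image hφ).measurableSet.compl]
    refine measure_mono_null ?_ h0
    intro x hx hxK
    exact hx ⟨x, hxK, rfl⟩
  half_lt_mass := by
    rw [Measure.map_apply hφ.measurable MeasurableSet.univ, Set.preimage_univ]
    exact ν.half_lt_mass
  mass_le_one := by
    rw [Measure.map_apply hφ.measurable MeasurableSet.univ, Set.preimage_univ]
    exact ν.mass_le_one

/-- `G` acts by left translation: `g • ν` is the image of `ν` under `x ↦ g * x`. -/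
noncomputable instance instMulAction (G : Type*) [Group G] [TopologicalSpace G]
    [IsTopologicalGroup G] [T2Space G] [MeasurableSpace G] [BorelSpace G] :
    MulAction G (KSSpace G) where
  smul g ν := ν.map (fun x => g * x) (continuous_const_mul g)
  one_smul ν := by
    apply KSSpace.ext
    change ν.meas.map (fun x => (1 : G) * x) = ν.meas
    simp
  mul_smul g h ν := by
    apply KSSpace.ext
    change ν.meas.map (fun x => g * h * x) =
      (ν.meas.map (fun x => h * x)).map (fun x => g * x)
    rw [Measure.map_map (continuous_const_mul g).measurable
      (continuous_const_mul h).measurable]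
    congr 1
    funext x
    exact mul_assoc g h x

/-- The inclusion of the measures on a subgroup `H` into the measures on `G`
(extension by zero). -/
noncomputable def incl {G : Type*} [Group G] [TopologicalSpace G] [T2Space G]
    [MeasurableSpace G] [BorelSpace G] (H : Subgroup G) (ν : KSSpace H) : KSSpace G :=
  ν.map (fun x : H => (x : G)) continuous_subtype_val

end KSSpace

/-- The same set `KSSpace G`, to be given the direct limit topology with respect to the
spaces `KSSpace (Gs n)`. -/
def KSLim {G : Type*} [Group G] [TopologicalSpace G] [MeasurableSpace G]
    (_Gs : ℕ → Subgroup G) : Type _ :=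
  KSSpace G

namespace KSLim

/-- The direct limit topology: a set is open if and only if, for every `n`, its intersection with
(that is, its preimage in) `KSSpace (Gs n)` is weak* open. -/
noncomputable instance instTopologicalSpace {G : Type*} [Group G] [TopologicalSpace G] [T2Space G]
    [MeasurableSpace G] [BorelSpace G] (Gs : ℕ → Subgroup G) :
    TopologicalSpace (KSLim Gs) :=
  ⨆ n, TopologicalSpace.coinduced (KSSpace.incl (Gs n)) inferInstance

noncomputable instance instMulAction {G : Type*} [Group G] [TopologicalSpace G]
    [IsTopologicalGroup G] [T2Space G] [MeasurableSpace G] [BorelSpace G]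
    (Gs : ℕ → Subgroup G) : MulAction G (KSLim Gs) :=
  KSSpace.instMulAction G

/-- The identity map, from the direct limit topology to the weak* topology. -/
def toKSSpace {G : Type*} [Group G] [TopologicalSpace G] [MeasurableSpace G]
    (Gs : ℕ → Subgroup G) (ν : KSLim Gs) : KSSpace G :=
  ν

end KSLim

/-- Two maps between `G`-spaces are `G`-homotopic if there is a homotopy between them, all of
whose stages are equivariant. -/
def GHomotopic (G : Type*) [Group G] {X Y : Type*} [TopologicalSpace X] [TopologicalSpace Y]
    [MulAction G X] [MulAction G Y] (f₀ f₁ : C(X, Y)) : Prop :=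
  ∃ F : ContinuousMap.Homotopy f₀ f₁, ∀ (t : unitInterval) (g : G) (x : X),
    F (t, g • x) = g • F (t, x)

/-- A continuous equivariant map is a `G`-homotopy equivalence if it has a continuous
equivariant inverse up to `G`-homotopy. -/
def IsGHomotopyEquiv (G : Type*) [Group G] {X Y : Type*} [TopologicalSpace X]
    [TopologicalSpace Y] [MulAction G X] [MulAction G Y] (f : C(X, Y)) : Prop :=
  (∀ (g : G) (x : X), f (g • x) = g • f x) ∧
  ∃ k : C(Y, X), (∀ (g : G) (y : Y), k (g • y) = g • k y) ∧
    GHomotopic G (k.comp f) (ContinuousMap.id X) ∧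
    GHomotopic G (f.comp k) (ContinuousMap.id Y)

end KasparovSkandalis

/-! The map Ξ multiplies each ν by a density and normalises (`concentrate`). It is built so that, as
ν varies near ν₀, the densities vanish off one fixed compact set. Such a set lies in a single `Gs
n`, so Ξ is continuous into the direct limit.

The bounds on the mass make this possible. If a compactly supported h has ∫ h dν > 1/2 near ν₀, any
translate of `f k` with integral above 1/2 must have support meeting that of h, as the total mass is
at most 1. This confines `excess f k ν` to a compact set independent of ν (`exists_compact_excess`).
One k does not serve every ν, since the excess may vanish almost everywhere. Weights built from the
total excesses of smaller index make the sum over k locally finite (`exists_weight_eq_zero`) yet of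
positive integral (`totalDensity_pos`). Everything is written in terms of x⁻¹y, hence equivariant.

The masses allowed form an interval, so the segment from Ξ(ν) to ν gives both homotopies. Because
Ξ(ν) is absolutely continuous with respect to ν, this segment stays in any `On (Gs n)` containing ν,
which gives continuity in the direct limit topology. -/

open Filter Set
open scoped Pointwise

namespace KSSpace

/-! ### Weak* continuity of integrals and convex combinations -/

section Weak

variable {G : Type*} [TopologicalSpace G] [MeasurableSpace G]

instance isFiniteMeasure_meas (ν : KSSpace G) : IsFiniteMeasure ν.meas :=
  ⟨ν.mass_le_one.trans_lt ENNReal.one_lt_top⟩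

lemma real_univ_le_one (ν : KSSpace G) : ν.meas.real univ ≤ 1 := by
  have := ENNReal.toReal_mono ENNReal.one_ne_top ν.mass_le_one
  simpa [Measure.real] using this

lemma half_lt_real_univ (ν : KSSpace G) : 1 / 2 < ν.meas.real univ := by
  have := ENNReal.toReal_strict_mono (measure_ne_top ν.meas univ) ν.half_lt_mass
  simpa [Measure.real] using this

lemma continuous_iff {X : Type*} [TopologicalSpace X] {u : X → KSSpace G} :
    Continuous u ↔ ∀ f : C_c(G, ℝ), Continuous fun x => ∫ y, f y ∂(u x).meas := by
  rw [continuous_induced_rng, continuous_pi_iff]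
  rfl

lemma continuous_integral (f : C_c(G, ℝ)) :
    Continuous fun ν : KSSpace G => ∫ y, f y ∂ν.meas :=
  continuous_iff.1 continuous_id f

variable [OpensMeasurableSpace G] [R1Space G]

omit [OpensMeasurableSpace G] in
lemma continuous_integral_of_eq_zero {f : G → ℝ} (hf : Continuous f) {K : Set G}
    (hK : IsCompact K) (h0 : ∀ y ∉ K, f y = 0) :
    Continuous fun ν : KSSpace G => ∫ y, f y ∂ν.meas :=
  continuous_integral ⟨⟨f, hf⟩, HasCompactSupport.intro hK h0⟩

/-- Integrals depending on a parameter are jointly continuous in the parameter and the measure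
when the integrands are locally supported in a fixed compact set. -/
lemma continuous_integral_parametric {X : Type*} [TopologicalSpace X] {F : X → G → ℝ}
    (hF : Continuous fun p : X × G => F p.1 p.2)
    (hs : ∀ x₀, ∃ K, IsCompact K ∧ ∀ᶠ x in 𝓝 x₀, ∀ y ∉ K, F x y = 0) :
    Continuous fun p : X × KSSpace G => ∫ y, F p.1 y ∂p.2.meas := by
  have hFx (x : X) : Continuous (F x) := hF.comp (by fun_prop : Continuous fun y => (x, y))
  rw [continuous_iff_continuousAt]
  rintro ⟨x₀, ν₀⟩
  obtain ⟨K, hK, hs⟩ := hs x₀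
  have hint {x : X} (hx : ∀ y ∉ K, F x y = 0) (ν : KSSpace G) : Integrable (F x) ν.meas :=
    (hFx x).integrable_of_hasCompactSupport (HasCompactSupport.intro hK hx)
  have hs₀ : ∀ y ∉ K, F x₀ y = 0 := hs.self_of_nhds
  rw [ContinuousAt, Metric.tendsto_nhds]
  intro ε hε
  have h1 : ∀ᶠ x in 𝓝 x₀, ∀ y ∈ K, |F x y - F x₀ y| < ε / 2 := by
    refine hK.eventually_forall_of_forall_eventually fun y _ => ?_
    have hc : Continuous fun p : X × G => |F p.1 p.2 - F x₀ p.2| :=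
      (hF.sub ((hFx x₀).comp continuous_snd)).abs
    exact hc.continuousAt.eventually_lt continuousAt_const (by simpa using half_pos hε)
  have h2 : ∀ᶠ ν in 𝓝 ν₀, dist (∫ y, F x₀ y ∂ν.meas) (∫ y, F x₀ y ∂ν₀.meas) < ε / 2 :=
    Metric.tendsto_nhds.1 (continuous_integral_of_eq_zero (hFx x₀) hK hs₀).continuousAt _
      (half_pos hε)
  filter_upwards [(h1.and hs).prod_nhds h2] with ⟨x, ν⟩ ⟨⟨hx1, hxs⟩, hν⟩
  -- This bound is uniform in ν because every ν has mass at most 1.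
  have h3 : dist (∫ y, F x y ∂ν.meas) (∫ y, F x₀ y ∂ν.meas) ≤ ε / 2 := by
    rw [Real.dist_eq, ← integral_sub (hint hxs ν) (hint hs₀ ν), ← Real.norm_eq_abs]
    have h4 : ∀ y, ‖F x y - F x₀ y‖ ≤ ε / 2 := fun y => by
      by_cases hy : y ∈ K
      · exact (hx1 y hy).le
      · rw [hxs y hy, hs₀ y hy, sub_zero, norm_zero]
        exact (half_pos hε).le
    refine (norm_integral_le_of_norm_le_const (Eventually.of_forall h4)).trans ?_
    exact mul_le_of_le_one_right (half_pos hε).le ν.real_univ_le_one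
  dsimp only at hν ⊢
  linarith [dist_triangle (∫ y, F x y ∂ν.meas) (∫ y, F x₀ y ∂ν.meas) (∫ y, F x₀ y ∂ν₀.meas)]

/-- The convex combination `(1 - t) μ + t ν`. -/
noncomputable def convexComb (t : unitInterval) (μ ν : KSSpace G) : KSSpace G where
  meas := ENNReal.ofReal (1 - t) • μ.meas + ENNReal.ofReal t • ν.meas
  compactSupport := by
    obtain ⟨K, hK, hK0⟩ := μ.compactSupport
    obtain ⟨L, hL, hL0⟩ := ν.compactSupport
    refine ⟨K ∪ L, hK.union hL, ?_⟩
    rw [Measure.add_apply, Measure.smul_apply, Measure.smul_apply,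
      measure_mono_null (compl_subset_compl.2 subset_union_left) hK0,
      measure_mono_null (compl_subset_compl.2 subset_union_right) hL0]
    simp
  half_lt_mass := by
    have : IsFiniteMeasure (ENNReal.ofReal (1 - t) • μ.meas) :=
      Measure.smul_finite _ ENNReal.ofReal_ne_top
    have : IsFiniteMeasure (ENNReal.ofReal t • ν.meas) :=
      Measure.smul_finite _ ENNReal.ofReal_ne_top
    rw [← ENNReal.toReal_lt_toReal (by simp) (measure_ne_top _ _)]
    have h0 := t.2.1
    have h1 := t.2.2
    have hμ := μ.half_lt_real_univ
    have hν := ν.half_lt_real_univ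
    change _ < Measure.real _ _
    rw [measureReal_add_apply, measureReal_ennreal_smul_apply, measureReal_ennreal_smul_apply,
      ENNReal.toReal_ofReal h0, ENNReal.toReal_ofReal (sub_nonneg.2 h1)]
    -- For t > 0 strictness comes from ν; at t = 0 it has to come from μ.
    rcases h0.eq_or_lt with h | h
    · simp only [← h]; norm_num at hμ ⊢; linarith
    · norm_num at hμ hν ⊢; nlinarith
  mass_le_one := by
    have h0 := t.2.1
    have h1 := t.2.2
    simp only [Measure.add_apply, Measure.smul_apply, smul_eq_mul]
    calc _ ≤ ENNReal.ofReal (1 - t) * 1 + ENNReal.ofReal t * 1 := by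
          gcongr
          exacts [μ.mass_le_one, ν.mass_le_one]
      _ = 1 := by
          rw [mul_one, mul_one, ← ENNReal.ofReal_add (sub_nonneg.2 h1) h0]
          simp

omit [OpensMeasurableSpace G] [R1Space G] in
@[simp] lemma convexComb_zero (μ ν : KSSpace G) : convexComb 0 μ ν = μ := by
  ext1; simp [convexComb]

omit [OpensMeasurableSpace G] [R1Space G] in
@[simp] lemma convexComb_one (μ ν : KSSpace G) : convexComb 1 μ ν = ν := by
  ext1; simp [convexComb]

omit [R1Space G] in
lemma integral_convexComb (t : unitInterval) (μ ν : KSSpace G) (f : C_c(G, ℝ)) :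
    ∫ y, f y ∂(convexComb t μ ν).meas =
      (1 - t) * ∫ y, f y ∂μ.meas + t * ∫ y, f y ∂ν.meas := by
  have hf (μ : KSSpace G) : Integrable f μ.meas :=
    f.continuous.integrable_of_hasCompactSupport f.hasCompactSupport
  rw [convexComb, integral_add_measure ((hf μ).smul_measure ENNReal.ofReal_ne_top)
    ((hf ν).smul_measure ENNReal.ofReal_ne_top), integral_smul_measure, integral_smul_measure,
    ENNReal.toReal_ofReal t.2.1, ENNReal.toReal_ofReal (sub_nonneg.2 t.2.2)]
  rfl

omit [R1Space G] in
lemma continuous_convexComb :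
    Continuous fun p : unitInterval × KSSpace G × KSSpace G =>
      convexComb p.1 p.2.1 p.2.2 := by
  refine continuous_iff.2 fun f => ?_
  simp only [integral_convexComb]
  have h1 := (continuous_integral f).comp
    (by fun_prop : Continuous fun p : unitInterval × KSSpace G × KSSpace G => p.2.1)
  have h2 := (continuous_integral f).comp
    (by fun_prop : Continuous fun p : unitInterval × KSSpace G × KSSpace G => p.2.2)
  have h3 : Continuous fun p : unitInterval × KSSpace G × KSSpace G => (p.1 : ℝ) := by fun_prop
  exact ((continuous_const.sub h3).mul h1).add (h3.mul h2)

end Weak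

/-! ### Translation and measures on open subgroups -/

section Group

variable {G : Type*} [Group G] [TopologicalSpace G] [IsTopologicalGroup G] [T2Space G]
  [MeasurableSpace G] [BorelSpace G]

lemma smul_meas (g : G) (ν : KSSpace G) : (g • ν).meas = ν.meas.map (g * ·) := rfl

lemma integral_smul (g : G) (ν : KSSpace G) (f : G → ℝ) :
    ∫ y, f y ∂(g • ν).meas = ∫ y, f (g * y) ∂ν.meas :=
  (Homeomorph.mulLeft g).measurableEmbedding.integral_map f

lemma smul_convexComb (g : G) (t : unitInterval) (μ ν : KSSpace G) :
    g • convexComb t μ ν = convexComb t (g • μ) (g • ν) := by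
  ext1
  rw [smul_meas, convexComb, Measure.map_add _ _ (continuous_const_mul g).measurable,
    Measure.map_smul, Measure.map_smul]
  rfl

instance instContinuousSMul [LocallyCompactSpace G] : ContinuousSMul G (KSSpace G) where
  continuous_smul := by
    refine continuous_iff.2 fun f => ?_
    simp only [integral_smul]
    refine continuous_integral_parametric (F := fun g y => f (g * y)) (by fun_prop) fun g₀ => ?_
    -- For g in N, the support of y ↦ f (g y) is g⁻¹ supp f, inside the compact set N⁻¹ supp f.
    obtain ⟨N, hN, hN₀⟩ := exists_compact_mem_nhds g₀
    refine ⟨N⁻¹ * tsupport f, hN.inv.mul f.hasCompactSupport, ?_⟩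
    filter_upwards [hN₀] with g hg y hy
    by_contra h
    exact hy ⟨g⁻¹, inv_mem_inv.2 hg, g * y, subset_tsupport _ h, by simp⟩

/-- The measures on `G` that are concentrated on the subgroup `H`. -/
def On (H : Subgroup G) : Set (KSSpace G) := {ν | ν.meas (H : Set G)ᶜ = 0}

omit [IsTopologicalGroup G] [T2Space G] [BorelSpace G] in
lemma convexComb_mem_On {H : Subgroup G} {μ ν : KSSpace G} (hμ : μ ∈ On H) (hν : ν ∈ On H)
    (t : unitInterval) : convexComb t μ ν ∈ On H := by
  change _ = _ at hμ hν ⊢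
  simp [convexComb, hμ, hν]

lemma smul_mem_On {H : Subgroup G} (hH : IsClosed (H : Set G)) {g : G} (hg : g ∈ H)
    {ν : KSSpace G} (hν : ν ∈ On H) : g • ν ∈ On H := by
  change _ = _ at hν ⊢
  rw [smul_meas, Measure.map_apply (continuous_const_mul g).measurable
    hH.measurableSet.compl]
  convert hν using 2
  ext x
  simp [H.mul_mem_cancel_left hg]

omit [IsTopologicalGroup G] in
lemma incl_mem_On {H : Subgroup G} (hH : IsClosed (H : Set G)) (ν : KSSpace H) :
    incl H ν ∈ On H := by
  change ν.meas.map (fun x : H => (x : G)) (H : Set G)ᶜ = 0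
  rw [Measure.map_apply continuous_subtype_val.measurable hH.measurableSet.compl]
  convert measure_empty (μ := ν.meas)
  ext x
  simp

omit [IsTopologicalGroup G] in
lemma mem_range_incl {H : Subgroup G} (hH : IsClosed (H : Set G)) {ν : KSSpace G}
    (hν : ν ∈ On H) : ∃ μ : KSSpace H, incl H μ = ν := by
  have he : MeasurableEmbedding (fun x : H => (x : G)) :=
    MeasurableEmbedding.subtype_coe hH.measurableSet
  have hmap : (ν.meas.comap (fun x : H => (x : G))).map (fun x : H => (x : G)) = ν.meas := by
    rw [he.map_comap]
    refine Measure.restrict_eq_self_of_ae_mem ?_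
    rw [ae_iff]
    convert (show ν.meas (H : Set G)ᶜ = 0 from hν) using 2
    ext x
    simp
  have huniv : ν.meas.comap (fun x : H => (x : G)) univ = ν.meas univ := by
    conv_rhs => rw [← hmap, he.map_apply]
    simp
  refine ⟨⟨ν.meas.comap (fun x : H => (x : G)), ?_, ?_, ?_⟩, KSSpace.ext hmap⟩
  · obtain ⟨K, hK, hK0⟩ := ν.compactSupport
    refine ⟨(fun x : H => (x : G)) ⁻¹' K, hH.isClosedEmbedding_subtypeVal.isCompact_preimage hK, ?_⟩
    rw [← hmap, he.map_apply] at hK0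
    exact hK0
  · rw [huniv]; exact ν.half_lt_mass
  · rw [huniv]; exact ν.mass_le_one

omit [IsTopologicalGroup G] in
lemma integral_incl {H : Subgroup G} (hH : IsClosed (H : Set G)) (ν : KSSpace H) (f : G → ℝ) :
    ∫ y, f y ∂(incl H ν).meas = ∫ y : H, f y ∂ν.meas :=
  (MeasurableEmbedding.subtype_coe hH.measurableSet).integral_map f

/-- Compactly supported functions restrict to H because H is closed, and extend by zero to G because
H is open. Both topologies are therefore tested by the same integrals. -/
lemma isInducing_incl {H : Subgroup G} (hH : IsOpen (H : Set G)) : IsInducing (incl H) := by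
  have hc := H.isClosed_of_isOpen hH
  refine isInducing_iff_nhds.2 fun ν => le_antisymm ?_ ?_
  · refine Continuous.tendsto ?_ ν |>.le_comap
    refine continuous_iff.2 fun f => ?_
    simp only [integral_incl hc]
    exact continuous_integral ⟨⟨fun x : H => f x, by fun_prop⟩,
      f.hasCompactSupport.comp_isClosedEmbedding hc.isClosedEmbedding_subtypeVal⟩
  · have h : ∀ f : C_c(H, ℝ), ∃ F : C_c(G, ℝ), ∀ x : H, F x = f x := fun f => by
      refine ⟨⟨⟨Function.extend Subtype.val f 0, ?_⟩, ?_⟩, ?_⟩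
      · exact f.hasCompactSupport.continuous_extend_zero hH f.continuous
      · exact f.hasCompactSupport.extend_zero continuous_subtype_val
      · exact fun x => Subtype.val_injective.extend_apply _ _ x
    choose F hF using h
    conv_rhs => rw [nhds_induced, nhds_pi, Filter.pi, comap_iInf]
    refine le_iInf fun f => ?_
    rw [comap_comap, ← tendsto_iff_comap]
    have := ((continuous_integral (F f)).tendsto (incl H ν)).comp
      (tendsto_comap (f := incl H))
    simpa [Function.comp_def, integral_incl hc, hF] using this

end Group

end KSSpace

/-! ### Cutoff functions and the concentrating map -/

namespace KSSpace

/-- A sequence of compactly supported functions with values in `[0, 1]`, eventually equal to one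
on each compact set. -/
structure CutoffSeq (G : Type*) [TopologicalSpace G] where
  toFun : ℕ → G → ℝ
  continuous : ∀ k, Continuous (toFun k)
  hasCompactSupport : ∀ k, HasCompactSupport (toFun k)
  nonneg : ∀ k x, 0 ≤ toFun k x
  le_one : ∀ k x, toFun k x ≤ 1
  exists_eq_one : ∀ K : Set G, IsCompact K → ∃ k, ∀ x ∈ K, toFun k x = 1

instance {G : Type*} [TopologicalSpace G] : CoeFun (CutoffSeq G) fun _ => ℕ → G → ℝ :=
  ⟨CutoffSeq.toFun⟩

lemma exists_cutoff {G : Type*} [TopologicalSpace G] [T2Space G] [LocallyCompactSpace G]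
    {K : Set G} (hK : IsCompact K) : ∃ f : G → ℝ, Continuous f ∧ HasCompactSupport f ∧
      (∀ x, 0 ≤ f x) ∧ (∀ x, f x ≤ 1) ∧ ∀ x ∈ K, f x = 1 := by
  obtain ⟨f, h1, -, hf, h01⟩ :=
    exists_continuous_one_zero_of_isCompact hK isClosed_empty (disjoint_empty K)
  exact ⟨f, f.continuous, hf, fun x => (h01 x).1, fun x => (h01 x).2, fun x hx => h1 hx⟩

lemma nonempty_cutoffSeq (G : Type*) [TopologicalSpace G] [T2Space G] [LocallyCompactSpace G]
    [SigmaCompactSpace G] : Nonempty (CutoffSeq G) := by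
  choose f hc hs h0 h1 hK using fun k : ℕ =>
    exists_cutoff ((CompactExhaustion.choice G).isCompact k)
  refine ⟨⟨f, hc, hs, h0, h1, fun K hK' => ?_⟩⟩
  obtain ⟨k, hk⟩ := (CompactExhaustion.choice G).exists_superset_of_isCompact hK'
  exact ⟨k, fun x hx => hK k x (hk hx)⟩

section Retraction

variable {G : Type*} [Group G] [TopologicalSpace G] [MeasurableSpace G]

variable (f : CutoffSeq G)

/-- The excess over `1 / 2` of the mass of `ν` near `x`, measured by the translate of `f k`. -/
noncomputable def excess (k : ℕ) (ν : KSSpace G) (x : G) : ℝ :=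
  max 0 (∫ y, f k (x⁻¹ * y) ∂ν.meas - 1 / 2)

noncomputable def totalExcess (k : ℕ) (ν : KSSpace G) : ℝ := ∫ x, excess f k ν x ∂ν.meas

/-- The weight of the `k`-th excess function; it vanishes for large `k`, locally uniformly. -/
noncomputable def weight (k : ℕ) (ν : KSSpace G) : ℝ :=
  max 0 (1 - k * ∑ j ∈ Finset.range k, totalExcess f j ν)

/-- The sum is locally finite in ν, by `exists_density_eq_sum`. -/
noncomputable def density (ν : KSSpace G) (x : G) : ℝ :=
  ∑' k, weight f k ν * excess f k ν x

noncomputable def totalDensity (ν : KSSpace G) : ℝ := ∫ x, density f ν x ∂ν.meas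

lemma excess_nonneg (k : ℕ) (ν : KSSpace G) (x : G) : 0 ≤ excess f k ν x := le_max_left _ _

lemma totalExcess_nonneg (k : ℕ) (ν : KSSpace G) : 0 ≤ totalExcess f k ν :=
  integral_nonneg (excess_nonneg f k ν)

lemma weight_nonneg (k : ℕ) (ν : KSSpace G) : 0 ≤ weight f k ν := le_max_left _ _

lemma density_nonneg (ν : KSSpace G) (x : G) : 0 ≤ density f ν x :=
  tsum_nonneg fun k => mul_nonneg (weight_nonneg f k ν) (excess_nonneg f k ν x)

variable [IsTopologicalGroup G] [T2Space G] [BorelSpace G]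

lemma excess_smul (k : ℕ) (g : G) (ν : KSSpace G) (x : G) :
    excess f k (g • ν) (g * x) = excess f k ν x := by
  simp [excess, integral_smul, mul_assoc]

lemma totalExcess_smul (k : ℕ) (g : G) (ν : KSSpace G) :
    totalExcess f k (g • ν) = totalExcess f k ν := by
  simp [totalExcess, integral_smul, excess_smul]

lemma density_smul (g : G) (ν : KSSpace G) (x : G) :
    density f (g • ν) (g * x) = density f ν x := by
  simp [density, weight, totalExcess_smul, excess_smul]

lemma totalDensity_smul (g : G) (ν : KSSpace G) :
    totalDensity f (g • ν) = totalDensity f ν := by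
  simp [totalDensity, integral_smul, density_smul]

variable [LocallyCompactSpace G]

omit [T2Space G] in
lemma continuous_excess (k : ℕ) :
    Continuous fun p : KSSpace G × G => excess f k p.1 p.2 := by
  have h : Continuous fun p : G × KSSpace G => ∫ y, f k (p.1⁻¹ * y) ∂p.2.meas := by
    refine continuous_integral_parametric (F := fun x y => f k (x⁻¹ * y))
      ((f.continuous k).comp (by fun_prop)) fun x₀ => ?_
    obtain ⟨N, hN, hN₀⟩ := exists_compact_mem_nhds x₀
    refine ⟨N * tsupport (f k), hN.mul (f.hasCompactSupport k), ?_⟩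
    filter_upwards [hN₀] with x hx y hy
    by_contra h
    exact hy ⟨x, hx, x⁻¹ * y, subset_tsupport _ h, by simp⟩
  exact continuous_const.max ((h.comp continuous_swap).sub continuous_const)

/-- Locally in `ν`, each excess function is supported in a fixed compact set, because two functions
with disjoint supports cannot both have integral greater than `1 / 2`. -/
lemma exists_compact_excess (ν₀ : KSSpace G) :
    ∃ U ∈ 𝓝 ν₀, ∀ k, ∃ K, IsCompact K ∧ ∀ ν ∈ U, ∀ x ∉ K, excess f k ν x = 0 := by
  obtain ⟨L, hL, hL0⟩ := ν₀.compactSupport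
  obtain ⟨h, hc, hs, h0, h1, hL1⟩ := exists_cutoff hL
  have hhalf : 1 / 2 < ∫ y, h y ∂ν₀.meas := by
    have : h =ᵐ[ν₀.meas] fun _ => (1 : ℝ) := by
      filter_upwards [show ∀ᵐ y ∂ν₀.meas, y ∈ L from hL0] with y hy using hL1 y hy
    rw [integral_congr_ae this, integral_const, smul_eq_mul, mul_one]
    exact ν₀.half_lt_real_univ
  refine ⟨{ν | 1 / 2 < ∫ y, h y ∂ν.meas},
    (continuous_integral ⟨⟨h, hc⟩, hs⟩).continuousAt.eventually (lt_mem_nhds hhalf), fun k =>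
    ⟨tsupport h * (tsupport (f k))⁻¹, hs.isCompact.mul (f.hasCompactSupport k).isCompact.inv,
      fun ν hν x hx => ?_⟩⟩
  refine max_eq_left (sub_nonpos.2 ?_)
  have hc' : Continuous fun y => f k (x⁻¹ * y) := (f.continuous k).comp (by fun_prop)
  have hs' : HasCompactSupport fun y => f k (x⁻¹ * y) :=
    (f.hasCompactSupport k).comp_homeomorph (Homeomorph.mulLeft x⁻¹)
  -- If both terms were nonzero at y, then x = y (y⁻¹ x) would lie in the excluded compact set. So
  -- at most one is nonzero, and each is at most 1.
  have hle : ∀ y, h y + f k (x⁻¹ * y) ≤ 1 := fun y => by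
    by_cases hy : h y = 0
    · rw [hy, zero_add]; exact f.le_one _ _
    · by_cases hy' : f k (x⁻¹ * y) = 0
      · rw [hy', add_zero]; exact h1 y
      · exact absurd ⟨y, subset_tsupport _ hy, y⁻¹ * x,
          by simpa using subset_tsupport _ hy', by simp⟩ hx
  have hi := hc.integrable_of_hasCompactSupport (μ := ν.meas) hs
  have hi' := hc'.integrable_of_hasCompactSupport (μ := ν.meas) hs'
  have hsum : ∫ y, h y ∂ν.meas + ∫ y, f k (x⁻¹ * y) ∂ν.meas ≤ 1 := by
    rw [← integral_add hi hi']
    refine (integral_mono (hi.add hi') (integrable_const 1) hle).trans ?_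
    simpa using ν.real_univ_le_one
  have : 1 / 2 < ∫ y, h y ∂ν.meas := hν
  linarith

omit [T2Space G] [LocallyCompactSpace G] in
/-- Integrals of a continuous family of functions, indexed by the measures and locally
supported in a fixed compact set. -/
lemma continuous_integral_diag {F : KSSpace G → G → ℝ}
    (hF : Continuous fun p : KSSpace G × G => F p.1 p.2)
    (hs : ∀ ν₀, ∃ U ∈ 𝓝 ν₀, ∃ K, IsCompact K ∧ ∀ ν ∈ U, ∀ y ∉ K, F ν y = 0) :
    Continuous fun ν : KSSpace G => ∫ y, F ν y ∂ν.meas :=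
  (continuous_integral_parametric hF fun ν₀ => by
    obtain ⟨U, hU, K, hK, h⟩ := hs ν₀
    exact ⟨K, hK, mem_of_superset hU h⟩).comp (continuous_id.prodMk continuous_id)

lemma continuous_totalExcess (k : ℕ) : Continuous (totalExcess f k) :=
  continuous_integral_diag (continuous_excess f k) fun ν₀ => by
    obtain ⟨U, hU, h⟩ := exists_compact_excess f ν₀
    exact ⟨U, hU, h k⟩

lemma continuous_weight (k : ℕ) : Continuous (weight f k) :=
  continuous_const.max (continuous_const.sub (continuous_const.mul
    (continuous_finsetSum _ fun j _ => continuous_totalExcess f j)))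

omit [T2Space G] in
lemma continuous_excess_right (k : ℕ) (ν : KSSpace G) : Continuous (excess f k ν) :=
  (continuous_excess f k).comp (by fun_prop : Continuous fun x => (ν, x))

lemma integrable_excess (k : ℕ) (ν : KSSpace G) : Integrable (excess f k ν) ν.meas := by
  obtain ⟨U, hU, h⟩ := exists_compact_excess f ν
  obtain ⟨K, hK, h⟩ := h k
  exact (continuous_excess_right f k ν).integrable_of_hasCompactSupport
    (HasCompactSupport.intro hK (h ν (mem_of_mem_nhds hU)))

/-- If ν lives on K and `f k` is 1 on K⁻¹K, then for x in K the translate of `f k` by x is 1 on K.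
The excess there is ν(G) − 1/2 > 0. -/
lemma exists_totalExcess_pos (ν : KSSpace G) : ∃ k, 0 < totalExcess f k ν := by
  obtain ⟨K, hK, hK0⟩ := ν.compactSupport
  obtain ⟨k, hk⟩ := f.exists_eq_one (K⁻¹ * K) (hK.inv.mul hK)
  have hK1 : ∀ᵐ y ∂ν.meas, y ∈ K := hK0
  have hex : ∀ x ∈ K, ν.meas.real univ - 1 / 2 ≤ excess f k ν x := fun x hx => by
    refine le_max_of_le_right (sub_le_sub_right (le_of_eq ?_) _)
    have : (fun y => f k (x⁻¹ * y)) =ᵐ[ν.meas] fun _ => (1 : ℝ) := by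
      filter_upwards [hK1] with y hy using hk _ ⟨x⁻¹, inv_mem_inv.2 hx, y, hy, rfl⟩
    rw [integral_congr_ae this, integral_const, smul_eq_mul, mul_one]
  refine ⟨k, lt_of_lt_of_le ?_ (integral_mono_ae (integrable_const (ν.meas.real univ - 1 / 2))
    (integrable_excess f k ν) ?_)⟩
  · rw [integral_const, smul_eq_mul]
    have := ν.half_lt_real_univ
    exact mul_pos (by linarith) (by linarith)
  · filter_upwards [hK1] with y hy using hex y hy

lemma exists_weight_eq_zero (ν₀ : KSSpace G) :
    ∃ U ∈ 𝓝 ν₀, ∃ N, ∀ ν ∈ U, ∀ k, N ≤ k → weight f k ν = 0 := by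
  obtain ⟨j, hj⟩ := exists_totalExcess_pos f ν₀
  -- Near ν₀ the j-th total excess stays above half its value c at ν₀, so k > 2/c makes k times the
  -- sum exceed 1. Taking k ≥ j + 1 puts j among the summands.
  obtain ⟨N, hN⟩ := exists_nat_gt (2 / totalExcess f j ν₀)
  refine ⟨{ν | totalExcess f j ν₀ / 2 < totalExcess f j ν},
    (continuous_totalExcess f j).continuousAt.eventually (lt_mem_nhds (half_lt_self hj)),
    max N (j + 1), fun ν hν k hk => max_eq_left (sub_nonpos.2 ?_)⟩
  have hν : totalExcess f j ν₀ / 2 < totalExcess f j ν := hν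
  have hNk : (N : ℝ) ≤ k := Nat.cast_le.2 ((le_max_left _ _).trans hk)
  have h1 : totalExcess f j ν ≤ ∑ i ∈ Finset.range k, totalExcess f i ν :=
    Finset.single_le_sum (fun i _ => totalExcess_nonneg f i ν)
      (Finset.mem_range.2 ((le_max_right N (j + 1)).trans hk))
  rw [div_lt_iff₀ hj] at hN
  nlinarith

lemma exists_density_eq_sum (ν₀ : KSSpace G) :
    ∃ U ∈ 𝓝 ν₀, ∃ N, ∀ ν ∈ U, ∀ x,
      density f ν x = ∑ k ∈ Finset.range N, weight f k ν * excess f k ν x := by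
  obtain ⟨U, hU, N, h⟩ := exists_weight_eq_zero f ν₀
  refine ⟨U, hU, N, fun ν hν x => tsum_eq_sum fun k hk => ?_⟩
  rw [h ν hν k (by simpa using hk), zero_mul]

lemma continuous_density : Continuous fun p : KSSpace G × G => density f p.1 p.2 := by
  rw [continuous_iff_continuousAt]
  rintro ⟨ν₀, x₀⟩
  obtain ⟨U, hU, N, h⟩ := exists_density_eq_sum f ν₀
  have hc : Continuous fun p : KSSpace G × G =>
      ∑ k ∈ Finset.range N, weight f k p.1 * excess f k p.1 p.2 :=
    continuous_finsetSum _ fun k _ =>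
      ((continuous_weight f k).comp continuous_fst).mul (continuous_excess f k)
  refine hc.continuousAt.congr ?_
  filter_upwards [continuous_fst.continuousAt.preimage_mem_nhds hU] with p hp
  exact (h p.1 hp p.2).symm

lemma continuous_density_right (ν : KSSpace G) : Continuous (density f ν) :=
  (continuous_density f).comp (by fun_prop : Continuous fun x => (ν, x))

lemma exists_compact_density (ν₀ : KSSpace G) :
    ∃ U ∈ 𝓝 ν₀, ∃ K, IsCompact K ∧ ∀ ν ∈ U, ∀ x ∉ K, density f ν x = 0 := by
  obtain ⟨U, hU, N, h⟩ := exists_density_eq_sum f ν₀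
  obtain ⟨V, hV, hK⟩ := exists_compact_excess f ν₀
  choose K hK hK0 using hK
  refine ⟨U ∩ V, inter_mem hU hV, ⋃ k ∈ Finset.range N, K k,
    (Finset.range N).isCompact_biUnion fun k _ => hK k, fun ν hν x hx => ?_⟩
  rw [h ν hν.1]
  refine Finset.sum_eq_zero fun k hk => ?_
  rw [hK0 k ν hν.2 x fun hxk => hx (mem_biUnion hk hxk), mul_zero]

lemma integrable_density (ν : KSSpace G) : Integrable (density f ν) ν.meas := by
  obtain ⟨U, hU, K, hK, h⟩ := exists_compact_density f ν
  exact (continuous_density_right f ν).integrable_of_hasCompactSupport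
    (HasCompactSupport.intro hK (h ν (mem_of_mem_nhds hU)))

lemma continuous_totalDensity : Continuous (totalDensity f) :=
  continuous_integral_diag (continuous_density f) (exists_compact_density f)

/-- For the least k with positive total excess, the sum in the weight is zero. That weight is 1, and
the density dominates the k-th excess. -/
lemma totalDensity_pos (ν : KSSpace G) : 0 < totalDensity f ν := by
  classical
  have hex := exists_totalExcess_pos f ν
  set k := Nat.find hex
  have hw : weight f k ν = 1 := by
    rw [weight, Finset.sum_eq_zero fun j hj => ?_]
    · simp
    · exact le_antisymm (not_lt.1 (Nat.find_min hex (Finset.mem_range.1 hj)))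
        (totalExcess_nonneg f j ν)
  refine (Nat.find_spec hex).trans_le
    (integral_mono (integrable_excess f k ν) (integrable_density f ν) fun x => ?_)
  obtain ⟨U, hU, N, h⟩ := exists_weight_eq_zero f ν
  have hs : Summable fun k => weight f k ν * excess f k ν x :=
    summable_of_ne_finset_zero (s := Finset.range N) fun k hk => by
      rw [h ν (mem_of_mem_nhds hU) k (by simpa using hk), zero_mul]
  have := hs.le_tsum k fun j _ => mul_nonneg (weight_nonneg f j ν) (excess_nonneg f j ν x)
  rwa [hw, one_mul] at this

/-- The probability measure proportional to `density f ν • ν`. Locally in `ν`, it is supported in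
a fixed compact set. -/
noncomputable def concentrate (ν : KSSpace G) : KSSpace G :=
  have huniv : ν.meas.withDensity
      (fun x => ENNReal.ofReal (density f ν x / totalDensity f ν)) univ = 1 := by
    rw [withDensity_apply _ MeasurableSet.univ, Measure.restrict_univ,
      ← ofReal_integral_eq_lintegral_ofReal ((integrable_density f ν).div_const _)
        (Eventually.of_forall fun x => div_nonneg (density_nonneg f ν x)
          (totalDensity_pos f ν).le), integral_div]
    change ENNReal.ofReal (totalDensity f ν / _) = 1
    rw [div_self (totalDensity_pos f ν).ne', ENNReal.ofReal_one]
  { meas := ν.meas.withDensity fun x => ENNReal.ofReal (density f ν x / totalDensity f ν)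
    compactSupport := by
      obtain ⟨K, hK, h⟩ := ν.compactSupport
      exact ⟨K, hK, withDensity_absolutelyContinuous _ _ h⟩
    half_lt_mass := by rw [huniv]; simp
    mass_le_one := huniv.le }

lemma concentrate_meas (ν : KSSpace G) : (concentrate f ν).meas =
    ν.meas.withDensity fun x => ENNReal.ofReal (density f ν x / totalDensity f ν) := rfl

lemma measurable_density_div (ν : KSSpace G) :
    Measurable fun x => ENNReal.ofReal (density f ν x / totalDensity f ν) :=
  ((continuous_density_right f ν).measurable.div_const _).ennreal_ofReal

lemma concentrate_smul (g : G) (ν : KSSpace G) :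
    concentrate f (g • ν) = g • concentrate f ν := by
  ext1
  refine Measure.ext fun s hs => ?_
  have hg := (continuous_const_mul g).measurable
  rw [smul_meas, concentrate_meas, concentrate_meas, Measure.map_apply hg hs,
    withDensity_apply _ hs, withDensity_apply _ (hg hs), smul_meas,
    setLIntegral_map hs (by simpa using measurable_density_div f (g • ν)) hg]
  simp only [density_smul, totalDensity_smul]

lemma concentrate_mem_On {H : Subgroup G} {ν : KSSpace G} (hν : ν ∈ On H) :
    concentrate f ν ∈ On H :=
  withDensity_absolutelyContinuous _ _ hν

lemma continuous_concentrate : Continuous (concentrate f) := by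
  refine continuous_iff.2 fun u => ?_
  have h (ν : KSSpace G) : ∫ y, u y ∂(concentrate f ν).meas =
      ∫ y, density f ν y / totalDensity f ν * u y ∂ν.meas := by
    rw [concentrate_meas, integral_withDensity_eq_integral_toReal_smul
      (measurable_density_div f ν) (by simp)]
    refine integral_congr_ae (Eventually.of_forall fun y => ?_)
    simp only [smul_eq_mul]
    rw [ENNReal.toReal_ofReal (div_nonneg (density_nonneg f ν y) (totalDensity_pos f ν).le)]
  simp only [h]
  -- The support of the test function u serves as the fixed compact set.
  refine continuous_integral_diag (F := fun ν y => density f ν y / totalDensity f ν * u y)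
    (((continuous_density f).div ((continuous_totalDensity f).comp continuous_fst)
      fun p => (totalDensity_pos f p.1).ne').mul (u.continuous.comp continuous_snd))
    fun ν₀ => ⟨univ, univ_mem, tsupport u, u.hasCompactSupport, fun ν _ y hy => ?_⟩
  simp [image_eq_zero_of_notMem_tsupport hy]

/-- Locally, `concentrate f` takes values in the measures on one member of an increasing sequence
of open subgroups exhausting `G`. -/
lemma exists_concentrate_mem_On {Gs : ℕ → Subgroup G} (hmono : Monotone Gs)
    (hopen : ∀ n, IsOpen (Gs n : Set G)) (hunion : (⋃ n, (Gs n : Set G)) = univ)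
    (ν₀ : KSSpace G) : ∃ U ∈ 𝓝 ν₀, ∃ n, ∀ ν ∈ U, concentrate f ν ∈ On (Gs n) := by
  obtain ⟨U, hU, K, hK, h⟩ := exists_compact_density f ν₀
  obtain ⟨n, hn⟩ := hK.elim_directed_cover (fun n => (Gs n : Set G)) hopen (by simp [hunion])
    (directed_of_isDirected_le fun _ _ hij => hmono hij)
  refine ⟨U, hU, n, fun ν hν => ?_⟩
  change (concentrate f ν).meas _ = 0
  rw [concentrate_meas, withDensity_apply _ (hopen n).measurableSet.compl]
  refine setLIntegral_eq_zero (hopen n).measurableSet.compl fun x hx => ?_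
  simp [h ν hν x fun hxK => hx (hn hxK)]

end Retraction

end KSSpace

/-! ### Continuity in the direct limit topology -/

namespace KSLim

open KSSpace

variable {G : Type*} [Group G] [TopologicalSpace G] [IsTopologicalGroup G]
  [T2Space G] [MeasurableSpace G] [BorelSpace G] {Gs : ℕ → Subgroup G}

/-- The identity map, from the weak* topology to the direct limit topology. -/
def ofKSSpace (Gs : ℕ → Subgroup G) (ν : KSSpace G) : KSLim Gs := ν

omit [IsTopologicalGroup G] in
lemma continuous_dom {Z : Type*} [TopologicalSpace Z] {u : KSLim Gs → Z} :
    Continuous u ↔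
      ∀ n, Continuous fun ν : KSSpace (Gs n) => u (ofKSSpace Gs (incl (Gs n) ν)) :=
  continuous_iSup_dom.trans (forall_congr' fun _ => continuous_coinduced_dom)

omit [IsTopologicalGroup G] in
lemma continuous_incl (n : ℕ) :
    Continuous fun ν : KSSpace (Gs n) => ofKSSpace Gs (incl (Gs n) ν) :=
  continuous_dom.1 continuous_id n

/-- A continuous map into the weak* topology is continuous into the direct limit topology if
locally it takes values in the measures on one of the subgroups. -/
lemma continuous_ofKSSpace (hopen : ∀ n, IsOpen (Gs n : Set G)) {X : Type*} [TopologicalSpace X]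
    {u : X → KSSpace G} (hu : Continuous u) (h : ∀ x, ∃ U ∈ 𝓝 x, ∃ n, ∀ y ∈ U, u y ∈ On (Gs n)) :
    Continuous fun x => ofKSSpace Gs (u x) := by
  rw [continuous_iff_continuousAt]
  intro x
  obtain ⟨U, hU, n, hn⟩ := h x
  have hc := (Gs n).isClosed_of_isOpen (hopen n)
  -- On U the map lifts to `KSSpace (Gs n)`; the lift is continuous because `incl` is inducing.
  choose v hv using fun y : U => mem_range_incl hc (hn y y.2)
  have hvc : Continuous v := by
    rw [(isInducing_incl (hopen n)).continuous_iff]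
    exact (hu.comp continuous_subtype_val).congr fun y => (hv y).symm
  have : ContinuousOn (fun x => ofKSSpace Gs (u x)) U := by
    rw [continuousOn_iff_continuous_domRestrict]
    exact ((continuous_incl n).comp hvc).congr fun y => congrArg (ofKSSpace Gs) (hv y)
  exact this.continuousAt hU

omit [IsTopologicalGroup G] [T2Space G] [BorelSpace G] in
lemma exists_mem_On (hmono : Monotone Gs) (hopen : ∀ n, IsOpen (Gs n : Set G))
    (hunion : (⋃ n, (Gs n : Set G)) = univ) (ν : KSSpace G) : ∃ n, ν ∈ On (Gs n) := by
  obtain ⟨K, hK, h⟩ := ν.compactSupport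
  obtain ⟨n, hn⟩ := hK.elim_directed_cover (fun n => (Gs n : Set G)) hopen (by simp [hunion])
    (directed_of_isDirected_le fun _ _ hij => hmono hij)
  exact ⟨n, measure_mono_null (compl_subset_compl.2 hn) h⟩

omit [IsTopologicalGroup G] [T2Space G] [BorelSpace G] in
lemma On_mono {H K : Subgroup G} (h : H ≤ K) : On H ⊆ On K := fun _ hν =>
  measure_mono_null (compl_subset_compl.2 h) hν

/-- A map on the product of a locally compact space with the direct limit is continuous if its
restrictions to the stages are. -/
lemma continuous_prod_dom (hmono : Monotone Gs) (hopen : ∀ n, IsOpen (Gs n : Set G))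
    (hunion : (⋃ n, (Gs n : Set G)) = univ) {Y Z : Type*} [TopologicalSpace Y]
    [LocallyCompactSpace Y] [TopologicalSpace Z] {F : Y × KSLim Gs → Z}
    (hF : ∀ n, Continuous fun p : Y × KSSpace (Gs n) =>
      F (p.1, ofKSSpace Gs (incl (Gs n) p.2))) : Continuous F := by
  have hFν (ν : KSLim Gs) : Continuous fun y => F (y, ν) := by
    obtain ⟨n, hn⟩ := exists_mem_On hmono hopen hunion ν
    obtain ⟨μ, rfl⟩ := mem_range_incl ((Gs n).isClosed_of_isOpen (hopen n)) hn
    exact (hF n).comp (by fun_prop : Continuous fun y => (y, μ))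
  -- Exponential law: continuity into C(Y, Z) can be checked on stages, and local compactness of Y
  -- permits uncurrying.
  let Φ : KSLim Gs → C(Y, Z) := fun ν => ⟨fun y => F (y, ν), hFν ν⟩
  have hΦ : Continuous Φ := continuous_dom.2 fun n =>
    ContinuousMap.continuous_of_continuous_uncurry _ ((hF n).comp continuous_swap)
  exact (ContinuousMap.continuous_uncurry_of_continuous ⟨Φ, hΦ⟩).comp continuous_swap

lemma continuous_toKSSpace (hopen : ∀ n, IsOpen (Gs n : Set G)) :
    Continuous (toKSSpace Gs) :=
  continuous_dom.2 fun n => (isInducing_incl (hopen n)).continuous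

variable [LocallyCompactSpace G]

/-- Group elements near a given one stay in some open `Gs m`, and they move measures on `Gs n` to
measures on `Gs (max m n)`. -/
lemma continuousSMul (hmono : Monotone Gs) (hopen : ∀ n, IsOpen (Gs n : Set G))
    (hunion : (⋃ n, (Gs n : Set G)) = univ) : ContinuousSMul G (KSLim Gs) where
  continuous_smul := by
    refine continuous_prod_dom hmono hopen hunion fun n => ?_
    have hc : Continuous fun p : G × KSSpace (Gs n) => p.1 • incl (Gs n) p.2 :=
      continuous_fst.smul ((isInducing_incl (hopen n)).continuous.comp continuous_snd)
    refine continuous_ofKSSpace hopen hc fun p => ?_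
    obtain ⟨m, hm⟩ := mem_iUnion.1 (hunion.symm ▸ mem_univ p.1 : p.1 ∈ ⋃ n, (Gs n : Set G))
    have hclosed (n : ℕ) := (Gs n).isClosed_of_isOpen (hopen n)
    refine ⟨_, continuous_fst.continuousAt.preimage_mem_nhds ((hopen m).mem_nhds hm), max m n,
      fun q hq => smul_mem_On (hclosed _) (hmono (le_max_left m n) hq) ?_⟩
    exact On_mono (hmono (le_max_right m n)) (incl_mem_On (hclosed n) q.2)

end KSLim

/-! ### The equivariant homotopy equivalence -/

open KSSpace KSLim

theorem theorem1 {G : Type*} [Group G] [TopologicalSpace G] [IsTopologicalGroup G]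
    [LocallyCompactSpace G] [SecondCountableTopology G] [T2Space G]
    [MeasurableSpace G] [BorelSpace G]
    (Gs : ℕ → Subgroup G) (hmono : Monotone Gs) (hopen : ∀ n, IsOpen (Gs n : Set G))
    (hunion : (⋃ n, (Gs n : Set G)) = Set.univ) :
    ContinuousSMul G (KSSpace G) ∧ ContinuousSMul G (KSLim Gs) ∧
      ∃ f : C(KSLim Gs, KSSpace G),
        (∀ ν, f ν = KSLim.toKSSpace Gs ν) ∧ IsGHomotopyEquiv G f := by
  obtain ⟨f⟩ := nonempty_cutoffSeq G
  have hΞ : Continuous fun ν => ofKSSpace Gs (concentrate f ν) :=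
    continuous_ofKSSpace hopen (continuous_concentrate f)
      (exists_concentrate_mem_On f hmono hopen hunion)
  have hH : Continuous fun p : unitInterval × KSSpace G =>
      convexComb p.1 (concentrate f p.2) p.2 :=
    continuous_convexComb.comp (continuous_fst.prodMk
      (((continuous_concentrate f).comp continuous_snd).prodMk continuous_snd))
  have hH' : Continuous fun p : unitInterval × KSLim Gs =>
      ofKSSpace Gs (convexComb p.1 (concentrate f (toKSSpace Gs p.2)) (toKSSpace Gs p.2)) := by
    refine continuous_prod_dom hmono hopen hunion fun n => ?_
    have hc : Continuous fun p : unitInterval × KSSpace (Gs n) =>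
        convexComb p.1 (concentrate f (incl (Gs n) p.2)) (incl (Gs n) p.2) :=
      hH.comp (continuous_fst.prodMk
        ((isInducing_incl (hopen n)).continuous.comp continuous_snd))
    -- Both ends of the segment are concentrated on `Gs n`, so no localisation is needed.
    refine continuous_ofKSSpace hopen hc fun p => ⟨univ, univ_mem, n, fun q _ => ?_⟩
    have h := incl_mem_On ((Gs n).isClosed_of_isOpen (hopen n)) q.2
    exact convexComb_mem_On (concentrate_mem_On f h) h q.1
  have hequiv (t : unitInterval) (g : G) (ν : KSSpace G) :
      convexComb t (concentrate f (g • ν)) (g • ν) = g • convexComb t (concentrate f ν) ν := by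
    rw [concentrate_smul, smul_convexComb]
  refine ⟨inferInstance, KSLim.continuousSMul hmono hopen hunion,
    ⟨toKSSpace Gs, continuous_toKSSpace hopen⟩, fun _ => rfl, fun _ _ => rfl,
    ⟨fun ν => ofKSSpace Gs (concentrate f ν), hΞ⟩, concentrate_smul f, ?_, ?_⟩
  · exact ⟨⟨⟨_, hH'⟩, fun ν => convexComb_zero (concentrate f ν) ν,
      fun ν => convexComb_one (concentrate f ν) ν⟩, hequiv⟩
  · exact ⟨⟨⟨_, hH⟩, fun ν => convexComb_zero (concentrate f ν) ν,
      fun ν => convexComb_one (concentrate f ν) ν⟩, hequiv⟩
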